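/- Let $\mathcal H,\mathcal G$ be real Hilbert spaces. Let $A\colon\mathcal H\to 2^{\mathcal H}$ be maximally $\rho$-monotone for some $\rho\in\mathbb R$ (that is, $\langle x-y\mid u-v\rangle\ge\rho\|x-y\|^2$ for all $(x,u),(y,v)$ in the graph of $A$, and the graph is maximal with respect to inclusion among graphs of operators with this property), let $C\colon\mathcal H\to\mathcal H$ be $\beta$-cocoercive for some $\beta>0$ (that is, $\langle x-y\mid Cx-Cy\rangle\ge\beta\|Cx-Cy\|^2$ for all $x,y\in\mathcal H$), let $B\colon\mathcal G\to\mathcal G$ be monotone and $\zeta$-Lipschitzian for some $\zeta>0$, let $L\colon\mathcal H\to\mathcal G$ and $K\colon\mathcal G\to\mathcal H$ be bounded linear operators, let $c\in\mathcal G$ and $\alpha\ge0$. Suppose that the set of solutions $x\in\mathcal H$ of $$0\in Ax+Cx+\alpha K(Lx-c)+KBLx\qquad(\mathrm P)$$ is nonempty. For a bounded linear operator $M\colon\mathcal G\to\mathcal H$ put $D_Mx=\alpha M(Lx-c)+MBLx$, $\kappa_M=\operatorname{Lip}(M(\alpha\,\mathrm{Id}+B)L)$ and $\widetilde\zeta_M=\operatorname{Lip}(MBL)$,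 where $\operatorname{Lip}T$ is the smallest Lipschitz constant of $T$. Let $\lambda_{\min}=\inf\{\langle x\mid KLx\rangle : \|x\|=1\}$. Suppose that 1. $D_K\ne0$; 2. $\hat\rho:=\rho+\alpha\lambda_{\min}-\widetilde\zeta_{L^*-K}\ge0$; 3. $(K_n)_{n\in\mathbb N}$ is a sequence of bounded linear operators from $\mathcal G$ to $\mathcal H$ with $\|K_n-K\|\le\omega_n$ for all $n$, where $\omega_n\ge0$ and $\sum_n\omega_n<+\infty$. Let $\chi_0=\dfrac{4\beta}{1+\sqrt{1+16\beta^2\kappa_K^2}}$, and let $\chi=\chi_0$ if $\rho\ge0$ and $\chi=\min\{\chi_0,-1/\rho\}$ if $\rho<0$. Let $\varepsilon\in\,]0,\chi/2[$, let $(\gamma_n)_{n\in\mathbb N}$ be a sequence in $[\varepsilon,\chi-\varepsilon]$, and let $(z_n)_{n\in\mathbb N}$ be generated from an arbitrary $z_0\in\mathcal H$ by the mismatched forward-backward-half-forward algorithm $$u_n=D_{K_n}z_n,\quad y_n=z_n-\gamma_n(Cz_n+u_n),\quad x_n=J_{\gamma_nA}(y_n),\quad z_{n+1}=x_n+\gamma_n(u_n-D_{K_n}x_n)\qquad(n\in\mathbb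 N),$$ where $J_{\gamma A}=(\mathrm{Id}+\gamma A)^{-1}$ is the resolvent. Then the following hold. (i) $(z_n)$ converges weakly to some solution of $(\mathrm P)$. (ii) If $\hat\rho>0$ and there exists $\bar\eta\in[0,1[$ such that $\omega_n=\omega_0\bar\eta^{\,n}$ for every $n\in\mathbb N$, then $(\mathrm P)$ has a unique solution $z^*$ and $(z_n)$ converges linearly to it, that is, there are $M\ge0$ and $q\in\,]0,1[$ with $\|z_n-z^*\|\le Mq^n$ for every $n\in\mathbb N$. -/

import Mathlib

open Filter Topology
open scoped NNReal

namespace AdjointMismatch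

noncomputable section

/-- A set-valued operator `A : H → 2^H` is `ρ`-monotone if
`⟪x - y, u - v⟫ ≥ ρ ‖x - y‖²` for all `(x, u)` and `(y, v)` in its graph. -/
def IsRhoMonotone {H : Type*} [NormedAddCommGroup H] [InnerProductSpace ℝ H]
    (ρ : ℝ) (A : H → Set H) : Prop :=
  ∀ x y u v : H, u ∈ A x → v ∈ A y → ρ * ‖x - y‖ ^ 2 ≤ inner ℝ (x - y) (u - v)

/-- `A` is maximally `ρ`-monotone: it is `ρ`-monotone and its graph is not strictly contained in
the graph of another `ρ`-monotone operator. -/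
def IsMaximallyRhoMonotone {H : Type*} [NormedAddCommGroup H] [InnerProductSpace ℝ H]
    (ρ : ℝ) (A : H → Set H) : Prop :=
  IsRhoMonotone ρ A ∧
    ∀ A' : H → Set H, IsRhoMonotone ρ A' → (∀ x, A x ⊆ A' x) → A' = A

/-- A single-valued operator `C : H → H` is `β`-cocoercive. -/
def IsCocoercive {H : Type*} [NormedAddCommGroup H] [InnerProductSpace ℝ H]
    (β : ℝ) (C : H → H) : Prop :=
  ∀ x y : H, β * ‖C x - C y‖ ^ 2 ≤ inner ℝ (x - y) (C x - C y)

/-- A single-valued operator `B : G → G` is monotone. -/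
def IsMonotoneMap {G : Type*} [NormedAddCommGroup G] [InnerProductSpace ℝ G]
    (B : G → G) : Prop :=
  ∀ x y : G, 0 ≤ inner ℝ (x - y) (B x - B y)

/-- `Lip T`, the smallest Lipschitz constant of a Lipschitzian operator. -/
def lipConst {E F : Type*} [NormedAddCommGroup E] [NormedAddCommGroup F] (T : E → F) : ℝ≥0 :=
  sInf {k : ℝ≥0 | LipschitzWith k T}

/-- The set-valued operator `γ A : x ↦ {γ u | u ∈ A x}`. -/
def scale {H : Type*} [NormedAddCommGroup H] [InnerProductSpace ℝ H]
    (γ : ℝ) (A : H → Set H) : H → Set H :=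
  fun x => {w | ∃ u ∈ A x, w = γ • u}

/-- The resolvent `J_A = (Id + A)⁻¹`, as a set-valued operator:
`x ∈ J_A y` iff `y ∈ x + A x`. -/
def resolventOp {H : Type*} [NormedAddCommGroup H] [InnerProductSpace ℝ H]
    (A : H → Set H) : H → Set H :=
  fun y => {x | ∃ u ∈ A x, y = x + u}

/-- `D_M : x ↦ α M (L x - c) + M B L x`. -/
def dOp {H G : Type*} [NormedAddCommGroup H] [InnerProductSpace ℝ H]
    [NormedAddCommGroup G] [InnerProductSpace ℝ G]
    (α : ℝ) (L : H →L[ℝ] G) (c : G) (B : G → G) (M : G →L[ℝ] H) : H → H :=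
  fun x => α • M (L x - c) + M (B (L x))

/-- The set of solutions `x` of `0 ∈ A x + C x + α K (L x - c) + K B L x`. -/
def solutions {H G : Type*} [NormedAddCommGroup H] [InnerProductSpace ℝ H]
    [NormedAddCommGroup G] [InnerProductSpace ℝ G]
    (A : H → Set H) (C : H → H) (α : ℝ) (L : H →L[ℝ] G) (c : G) (B : G → G)
    (K : G →L[ℝ] H) : Set H :=
  {x | ∃ a ∈ A x, 0 = a + C x + α • K (L x - c) + K (B (L x))}

/-- `κ_M = Lip (M (α Id + B) L)`. -/
def kappa {H G : Type*} [NormedAddCommGroup H] [InnerProductSpace ℝ H]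
    [NormedAddCommGroup G] [InnerProductSpace ℝ G]
    (α : ℝ) (L : H →L[ℝ] G) (B : G → G) (M : G →L[ℝ] H) : ℝ :=
  lipConst (fun x : H => M (α • L x + B (L x)))

/-- `ζ̃_M = Lip (M B L)`. -/
def zetaTilde {H G : Type*} [NormedAddCommGroup H] [InnerProductSpace ℝ H]
    [NormedAddCommGroup G] [InnerProductSpace ℝ G]
    (L : H →L[ℝ] G) (B : G → G) (M : G →L[ℝ] H) : ℝ :=
  lipConst (fun x : H => M (B (L x)))

/-- `λ_min = inf {⟪x, K L x⟫ | ‖x‖ = 1}`. -/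
def lambdaMin {H G : Type*} [NormedAddCommGroup H] [InnerProductSpace ℝ H]
    [NormedAddCommGroup G] [InnerProductSpace ℝ G]
    (L : H →L[ℝ] G) (K : G →L[ℝ] H) : ℝ :=
  sInf {r : ℝ | ∃ x : H, ‖x‖ = 1 ∧ r = inner ℝ x (K (L x))}

/-- `ρ̂ = ρ + α λ_min - ζ̃_{L* - K}`. -/
def rhoHat {H G : Type*} [NormedAddCommGroup H] [InnerProductSpace ℝ H] [CompleteSpace H]
    [NormedAddCommGroup G] [InnerProductSpace ℝ G] [CompleteSpace G]
    (ρ α : ℝ) (L : H →L[ℝ] G) (B : G → G) (K : G →L[ℝ] H) : ℝ :=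
  ρ + α * lambdaMin L K - zetaTilde L B (ContinuousLinearMap.adjoint L - K)

/-- The step-size bound `χ`, as a function of `β`, `κ = κ_K` and `ρ`. -/
def chi (β κ ρ : ℝ) : ℝ :=
  if 0 ≤ ρ then 4 * β / (1 + √(1 + 16 * β ^ 2 * κ ^ 2))
  else min (4 * β / (1 + √(1 + 16 * β ^ 2 * κ ^ 2))) (-(1 / ρ))

/-- The sequences `u, y, x, z` are generated by the forward-backward-half-forward iteration with
step sizes `γ n` and operators `Kn n` in place of `K`. For a maximally `ρ`-monotone `A` and
`γ n * ρ > -1` the resolvent of `γ n • A` is single-valued with full domain, so that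
`x n ∈ J_{γ n A} (y n)` says `x n = J_{γ n A} (y n)`. -/
structure IsFBHF {H G : Type*} [NormedAddCommGroup H] [InnerProductSpace ℝ H]
    [NormedAddCommGroup G] [InnerProductSpace ℝ G]
    (A : H → Set H) (C : H → H) (α : ℝ) (L : H →L[ℝ] G) (c : G) (B : G → G)
    (Kn : ℕ → G →L[ℝ] H) (γ : ℕ → ℝ) (u y x z : ℕ → H) : Prop where
  u_eq : ∀ n, u n = dOp α L c B (Kn n) (z n)
  y_eq : ∀ n, y n = z n - γ n • (C (z n) + u n)
  x_mem : ∀ n, x n ∈ resolventOp (scale (γ n) A) (y n)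
  z_succ : ∀ n, z (n + 1) = x n + γ n • (u n - dOp α L c B (Kn n) (x n))

/-- Weak convergence of a sequence. -/
def ConvergesWeakly {H : Type*} [NormedAddCommGroup H] [InnerProductSpace ℝ H]
    (z : ℕ → H) (l : H) : Prop :=
  Tendsto (fun n => toWeakSpace ℝ H (z n)) atTop (𝓝 (toWeakSpace ℝ H l))

/-- Linear (that is, geometric) convergence of a sequence. -/
def ConvergesLinearly {H : Type*} [NormedAddCommGroup H] [InnerProductSpace ℝ H]
    (z : ℕ → H) (l : H) : Prop :=
  ∃ M q : ℝ, 0 ≤ M ∧ 0 < q ∧ q < 1 ∧ ∀ n, ‖z n - l‖ ≤ M * q ^ n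

end

end AdjointMismatch

open AdjointMismatch

/-! Neither `A` nor `D_K` need be monotone, but `A + C + D_K` is `ρ̂`-monotone: writing `K = L* -
(L* - K)`, the part `L* B L` is monotone and the mismatch costs at most `ζ̃`. Hence only the sum of
the moduli matters, and `ρ̂ ≥ 0` suffices for the usual analysis of the algorithm.

The step-size bound is the positive root of `1 - γ/(2β) - γ²κ²`, so one step (`fbhf_step`) decreases
`‖z n - p‖²` by a multiple of `‖z n - x n‖²` plus a multiple of `ρ̂ ‖x n - p‖²`. Replacing `K` by
`Kn n` costs `O(ω n) (1 + ‖z n - p‖² + ‖z n - x n‖²)`. As `ω` is summable, `(z n)` is quasi-Fejér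
with respect to the solutions and `z n - x n → 0`.

For (i), Opial's lemma reduces weak convergence to showing that weak cluster points are solutions.
They are monotonically related to the graph of `A + C + D_K`; Minty's theorem makes the resolvents
of `A` everywhere defined, and Banach's fixed point theorem then turns this relation into a zero.
For (ii), `ρ̂ > 0` makes the recursion contractive up to a geometric error. -/

/-! ### Minty's theorem, resolvents, and zeros of Lipschitzian perturbations. -/

/-- A closed convex set of pairs `(p, r)` on which `r + ‖p‖² / 2` is bounded below contains a
minimiser of that function, and the first order optimality condition holds there. -/
lemma exists_min_add_half_sq {E : Type*} [NormedAddCommGroup E] [InnerProductSpace ℝ E]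
    [CompleteSpace E] (S : Set (E × ℝ)) (hconv : Convex ℝ S) (hcl : IsClosed S)
    (hne : S.Nonempty) (hbd : ∀ q ∈ S, 0 ≤ q.2 + ‖q.1‖ ^ 2 / 2) :
    ∃ q ∈ S, ∀ q' ∈ S, q.2 - inner ℝ q.1 (q'.1 - q.1) ≤ q'.2 := by
  set f : E × ℝ → ℝ := fun q => q.2 + ‖q.1‖ ^ 2 / 2 with hf
  set m := sInf (f '' S) with hm
  have hbdd : BddBelow (f '' S) := ⟨0, by rintro _ ⟨q, hq, rfl⟩; exact hbd q hq⟩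
  have hle : ∀ q ∈ S, m ≤ f q := fun q hq => csInf_le hbdd ⟨q, hq, rfl⟩
  have hex : ∀ n : ℕ, ∃ q ∈ S, f q < m + 1 / ((n : ℝ) + 1) := by
    intro n
    obtain ⟨_, ⟨q, hq, rfl⟩, h⟩ := exists_lt_of_csInf_lt (hne.image f)
      (lt_add_of_pos_right m (Nat.one_div_pos_of_nat (α := ℝ) (n := n)))
    exact ⟨q, hq, h⟩
  choose q hqS hq using hex
  -- The midpoint of `a` and `b` lies in `S`, so the parallelogram law makes the first components of
  -- a minimising sequence Cauchy; the second components then converge because `f` does.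
  have hpar : ∀ a ∈ S, ∀ b ∈ S, ‖a.1 - b.1‖ ^ 2 ≤ 4 * (f a + f b - 2 * m) := by
    intro a ha b hb
    have h := hle _ (hconv ha hb (by norm_num : (0 : ℝ) ≤ 1 / 2)
      (by norm_num : (0 : ℝ) ≤ 1 / 2) (by norm_num))
    simp only [hf, Prod.fst_add, Prod.snd_add, Prod.smul_fst, Prod.smul_snd, smul_eq_mul,
      ← smul_add, norm_smul, Real.norm_eq_abs, mul_pow] at h ⊢
    have := parallelogram_law_with_norm ℝ a.1 b.1
    rw [abs_of_pos (by norm_num : (0 : ℝ) < 1 / 2)] at h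
    nlinarith
  have h0 : Tendsto (fun n : ℕ => 1 / ((n : ℝ) + 1)) atTop (𝓝 0) :=
    tendsto_one_div_add_atTop_nhds_zero_nat
  have hfq : Tendsto (fun n => f (q n)) atTop (𝓝 m) := by
    refine tendsto_of_tendsto_of_tendsto_of_le_of_le tendsto_const_nhds
      (by simpa using h0.const_add m) (fun n => hle _ (hqS n)) (fun n => (hq n).le)
  have hC : CauchySeq (fun n => (q n).1) := by
    refine cauchySeq_of_le_tendsto_0 (fun n : ℕ => √(8 * (1 / ((n : ℝ) + 1)))) ?_ ?_
    · intro n k N hn hk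
      rw [dist_eq_norm]
      refine Real.le_sqrt_of_sq_le ((hpar _ (hqS n) _ (hqS k)).trans ?_)
      have e1 : 1 / ((n : ℝ) + 1) ≤ 1 / ((N : ℝ) + 1) := Nat.one_div_le_one_div hn
      have e2 : 1 / ((k : ℝ) + 1) ≤ 1 / ((N : ℝ) + 1) := Nat.one_div_le_one_div hk
      linarith [hq n, hq k]
    · have := (h0.const_mul 8).sqrt
      simpa using this
  obtain ⟨p, hp⟩ := cauchySeq_tendsto_of_complete hC
  have hr : Tendsto (fun n => (q n).2) atTop (𝓝 (m - ‖p‖ ^ 2 / 2)) := by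
    have := hfq.sub ((hp.norm.pow 2).div_const 2)
    simpa [hf] using this
  have hmem : (p, m - ‖p‖ ^ 2 / 2) ∈ S :=
    hcl.mem_of_tendsto (hp.prodMk_nhds hr) (Eventually.of_forall hqS)
  refine ⟨_, hmem, fun q' hq' => ?_⟩
  have key : ∀ t : ℝ, 0 < t → t ≤ 1 →
      0 ≤ (q'.2 - (m - ‖p‖ ^ 2 / 2)) + inner ℝ p (q'.1 - p) + t * (‖q'.1 - p‖ ^ 2 / 2) := by
    intro t ht ht1
    have h := hle _ (hconv.add_smul_sub_mem hmem hq' ⟨ht.le, ht1⟩)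
    simp only [hf, Prod.fst_add, Prod.snd_add, Prod.smul_fst, Prod.smul_snd, smul_eq_mul,
      Prod.fst_sub, Prod.snd_sub] at h
    rw [norm_add_sq_real, inner_smul_right, norm_smul, Real.norm_eq_abs, abs_of_pos ht] at h
    have : 0 ≤ t * ((q'.2 - (m - ‖p‖ ^ 2 / 2)) + inner ℝ p (q'.1 - p)
      + t * (‖q'.1 - p‖ ^ 2 / 2)) := by linarith
    exact nonneg_of_mul_nonneg_right this ht
  have hlim : Tendsto (fun t : ℝ => (q'.2 - (m - ‖p‖ ^ 2 / 2)) + inner ℝ p (q'.1 - p)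
      + t * (‖q'.1 - p‖ ^ 2 / 2)) (𝓝[>] 0)
      (𝓝 ((q'.2 - (m - ‖p‖ ^ 2 / 2)) + inner ℝ p (q'.1 - p) + 0 * (‖q'.1 - p‖ ^ 2 / 2))) :=
    Tendsto.mono_left (Continuous.tendsto (by fun_prop) 0) nhdsWithin_le_nhds
  have := ge_of_tendsto hlim (by
    filter_upwards [Ioo_mem_nhdsGT (zero_lt_one' ℝ)] with t ht
    exact key t ht.1 ht.2.le)
  linarith

/-- Minty's theorem: a maximally monotone graph contains a point `(x, -x)`. -/
lemma exists_neg_self_mem_of_maximal_monotone {H : Type*} [NormedAddCommGroup H]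
    [InnerProductSpace ℝ H] [CompleteSpace H] (Γ : Set (H × H))
    (hmono : ∀ p ∈ Γ, ∀ q ∈ Γ, 0 ≤ inner ℝ (p.1 - q.1) (p.2 - q.2))
    (hmax : ∀ p : H × H, (∀ q ∈ Γ, 0 ≤ inner ℝ (p.1 - q.1) (p.2 - q.2)) → p ∈ Γ) :
    ∃ x : H, (x, -x) ∈ Γ := by
  have hΓ : Γ.Nonempty := by
    by_contra h
    rw [Set.not_nonempty_iff_eq_empty] at h
    have := hmax (0, 0) (by simp [h])
    simp [h] at this
  have hself : ∀ p ∈ Γ, ∀ q ∈ Γ,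
      inner ℝ p.1 q.2 + inner ℝ q.1 p.2 - inner ℝ q.1 q.2 ≤ inner ℝ p.1 p.2 := by
    intro p hp q hq
    have := hmono p hp q hq
    simp only [inner_sub_left, inner_sub_right] at this
    linarith
  -- The Fitzpatrick function of `Γ` dominates the duality product: a pair where it were smaller
  -- would be related to all of `Γ`, hence in `Γ`, and taking `q` to be that pair gives a
  -- contradiction.
  have hF : ∀ (x u : H) (r : ℝ),
      (∀ q ∈ Γ, inner ℝ x q.2 + inner ℝ q.1 u - inner ℝ q.1 q.2 ≤ r) → inner ℝ x u ≤ r := by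
    intro x u r h
    by_contra! hlt
    have hmem : (x, u) ∈ Γ := hmax _ fun q hq => by
      have := h q hq
      simp only [inner_sub_left, inner_sub_right]
      linarith
    have := h _ hmem
    simp only at this
    linarith
  -- The epigraph of the Fitzpatrick function, over the product with its Hilbert norm.
  set S : Set (WithLp 2 (H × H) × ℝ) :=
    ⋂ q ∈ Γ, {w | inner ℝ w.1.fst q.2 + inner ℝ q.1 w.1.snd - inner ℝ q.1 q.2 ≤ w.2} with hS
  have hSmem : ∀ w, w ∈ S ↔ ∀ q ∈ Γ,
      inner ℝ w.1.fst q.2 + inner ℝ q.1 w.1.snd - inner ℝ q.1 q.2 ≤ w.2 := by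
    intro w; simp [hS]
  obtain ⟨w, hwS, hw⟩ := exists_min_add_half_sq S
    (by
      intro v hv w hw a b ha hb hab
      rw [hSmem] at hv hw ⊢
      intro q hq
      have h1 := mul_le_mul_of_nonneg_left (hv q hq) ha
      have h2 := mul_le_mul_of_nonneg_left (hw q hq) hb
      simp only [Prod.fst_add, Prod.snd_add, Prod.smul_fst, Prod.smul_snd, WithLp.add_fst,
        WithLp.add_snd, WithLp.smul_fst, WithLp.smul_snd, inner_add_left, inner_add_right,
        real_inner_smul_left, real_inner_smul_right, smul_eq_mul]
      have e : inner ℝ q.1 q.2 = a * inner ℝ q.1 q.2 + b * inner ℝ q.1 q.2 := by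
        rw [← add_mul, hab, one_mul]
      linarith)
    (by
      refine isClosed_biInter fun q _ => isClosed_le ?_ ?_ <;> fun_prop)
    (by
      obtain ⟨p, hp⟩ := hΓ
      refine ⟨(WithLp.toLp 2 p, inner ℝ p.1 p.2), ?_⟩
      rw [hSmem]
      exact fun q hq => hself p hp q hq)
    (by
      intro v hv
      have := hF _ _ _ ((hSmem v).1 hv)
      rw [WithLp.prod_norm_sq_eq_of_L2]
      have h2 := norm_add_sq_real v.1.fst v.1.snd
      nlinarith [sq_nonneg ‖v.1.fst + v.1.snd‖])
  have hr := hF _ _ _ ((hSmem w).1 hwS)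
  set x := w.1.fst
  set u := w.1.snd
  -- Optimality of `w`, tested at the epigraph points over `Γ`, combined with `⟪x, u⟫ ≤ w.2`. It
  -- puts `(-u, -x)` in `Γ`, and taking `q` to be this very point forces `x + u = 0`.
  have hkey : ∀ q ∈ Γ, ‖x + u‖ ^ 2 ≤ inner ℝ (-u - q.1) (-x - q.2) := by
    intro q hq
    have h := hw (WithLp.toLp 2 q, inner ℝ q.1 q.2) ((hSmem _).2 fun p hp => hself q hq p hp)
    simp only [WithLp.prod_inner_apply, WithLp.ofLp_sub, Prod.fst_sub, Prod.snd_sub] at h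
    change w.2 - (inner ℝ x (q.1 - x) + inner ℝ u (q.2 - u)) ≤ inner ℝ q.1 q.2 at h
    rw [norm_add_sq_real]
    simp only [inner_sub_left, inner_sub_right, inner_neg_left, inner_neg_right,
      real_inner_self_eq_norm_sq] at h ⊢
    have e1 := real_inner_comm x u
    have e2 := real_inner_comm x q.1
    linarith
  have hmem : (-u, -x) ∈ Γ := hmax _ fun q hq => (sq_nonneg _).trans (hkey q hq)
  have h := hkey _ hmem
  simp only [sub_self, inner_zero_left] at h
  have hxu : x + u = 0 := norm_eq_zero.1 (pow_eq_zero_iff two_ne_zero |>.1 (le_antisymm h (sq_nonneg _)))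
  refine ⟨-u, ?_⟩
  rwa [eq_neg_of_add_eq_zero_left hxu] at hmem

section
variable {H : Type*} [NormedAddCommGroup H] [InnerProductSpace ℝ H]

/-- Adjoining the single pair `(x, u)` to the graph keeps it `ρ`-monotone, so maximality absorbs it.
-/
lemma AdjointMismatch.IsMaximallyRhoMonotone.mem_of_related {ρ : ℝ} {A : H → Set H}
    (hA : IsMaximallyRhoMonotone ρ A) {x u : H}
    (h : ∀ y, ∀ v ∈ A y, ρ * ‖x - y‖ ^ 2 ≤ inner ℝ (x - y) (u - v)) : u ∈ A x := by
  have := hA.2 (fun y => A y ∪ {v | y = x ∧ v = u}) ?_ fun y => Set.subset_union_left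
  · rw [← this]; simp
  · rintro a b v w (hv | ⟨rfl, rfl⟩) (hw | ⟨rfl, rfl⟩)
    · exact hA.1 _ _ _ _ hv hw
    · rw [← neg_sub b a, ← neg_sub w v, inner_neg_neg, norm_neg]
      exact h _ _ hv
    · exact h _ _ hw
    · simp

/-- Minty's theorem is applied to `s (A - ρ Id) - y'`, which is maximally monotone. Dividing `y = x
+ t v` by `1 + t ρ` turns it into `y' = x + s (v - ρ x)`, whence the values of `s` and `y'`. -/
lemma AdjointMismatch.IsMaximallyRhoMonotone.exists_resolvent [CompleteSpace H] {ρ : ℝ}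
    {A : H → Set H} (hA : IsMaximallyRhoMonotone ρ A) {t : ℝ} (ht : 0 < t) (htρ : 0 < 1 + t * ρ)
    (y : H) : ∃ x, ∃ v ∈ A x, y = x + t • v := by
  set s := t / (1 + t * ρ)
  have hs : 0 < s := div_pos ht htρ
  set y' := (1 + t * ρ)⁻¹ • y
  obtain ⟨x, hx⟩ : ∃ x : H, (x, -x) ∈ {p : H × H | s⁻¹ • (p.2 + y') + ρ • p.1 ∈ A p.1} := by
    apply exists_neg_self_mem_of_maximal_monotone
    · intro p hp q hq
      have := hA.1 _ _ _ _ hp hq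
      have e : s⁻¹ • (p.2 + y') + ρ • p.1 - (s⁻¹ • (q.2 + y') + ρ • q.1)
        = s⁻¹ • (p.2 - q.2) + ρ • (p.1 - q.1) := by module
      rw [e, inner_add_right, real_inner_smul_right, real_inner_smul_right,
        real_inner_self_eq_norm_sq] at this
      exact nonneg_of_mul_nonneg_right (by linarith : 0 ≤ s⁻¹ * _) (inv_pos.2 hs)
    · intro p hp
      refine hA.mem_of_related fun z v hv => ?_
      have e0 : s⁻¹ • (s • (v - ρ • z) - y' + y') + ρ • z = v := by
        rw [sub_add_cancel, smul_smul, inv_mul_cancel₀ hs.ne', one_smul, sub_add_cancel]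
      have := hp (z, s • (v - ρ • z) - y') (by rwa [Set.mem_ofPred_eq, e0])
      have e : s⁻¹ • (p.2 + y') + ρ • p.1 - v
        = s⁻¹ • (p.2 - (s • (v - ρ • z) - y')) + ρ • (p.1 - z) := by
        conv_lhs => rw [← e0]
        module
      rw [e, inner_add_right, real_inner_smul_right, real_inner_smul_right,
        real_inner_self_eq_norm_sq]
      have := mul_nonneg (inv_pos.2 hs).le this
      simp only at this
      linarith
  refine ⟨x, _, hx, ?_⟩
  have h1 : t * s⁻¹ = 1 + t * ρ := by simp only [s]; field_simp
  rw [smul_add, smul_smul, h1, smul_add, smul_smul, mul_inv_cancel₀ htρ.ne']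
  module

/-- A point that is monotonically related to the graph of `A + T`, with `T` Lipschitzian, is a
zero of `A + T`. -/
lemma AdjointMismatch.IsMaximallyRhoMonotone.neg_mem_of_related [CompleteSpace H] {ρ : ℝ}
    {A : H → Set H} (hA : IsMaximallyRhoMonotone ρ A) {T : H → H} {k : ℝ≥0}
    (hT : LipschitzWith k T) {x : H}
    (h : ∀ y, ∀ v ∈ A y, inner ℝ (x - y) (v + T y) ≤ 0) : -T x ∈ A x := by
  -- Small enough that the resolvent of `t A` exists and that composing it with `p ↦ x - t T p`
  -- gives a `1/2`-contraction. At its fixed point `p`, `x - p = t (v + T p)` with `v ∈ A p`, and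
  -- the hypothesis at `(p, v)` yields `t ‖v + T p‖² ≤ 0`, so `x = p`.
  set t : ℝ := (2 * (|ρ| + k + 1))⁻¹ with ht_def
  have hpos : (0 : ℝ) < |ρ| + k + 1 := by positivity
  have ht : 0 < t := by positivity
  have hle : t * |ρ| + t * k < 1 / 2 := by
    have : t * (|ρ| + k + 1) = 1 / 2 := by rw [ht_def]; field_simp
    nlinarith
  have htρ : 1 - t * |ρ| ≤ 1 + t * ρ := by nlinarith [neg_abs_le ρ]
  have htk : 0 ≤ t * k := by positivity
  have h0 : 0 ≤ t * |ρ| := by positivity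
  choose J V hV hJ using hA.exists_resolvent ht (by linarith)
  have hJlip : ∀ a b, (1 + t * ρ) * ‖J a - J b‖ ≤ ‖a - b‖ := by
    intro a b
    have h1 := hA.1 _ _ _ _ (hV a) (hV b)
    have h2 : a - b = (J a - J b) + t • (V a - V b) := by
      nth_rewrite 1 [hJ a, hJ b]; module
    have h3 : (1 + t * ρ) * ‖J a - J b‖ ^ 2 ≤ inner ℝ (J a - J b) (a - b) := by
      rw [h2, inner_add_right, real_inner_smul_right, real_inner_self_eq_norm_sq]
      nlinarith
    have h4 := h3.trans (real_inner_le_norm _ _)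
    rcases (norm_nonneg (J a - J b)).eq_or_lt with h5 | h5
    · rw [← h5]; simp
    · exact le_of_mul_le_mul_left (by linarith) h5
  have hcontr : ContractingWith (1 / 2) (fun p => J (x - t • T p)) := by
    refine ⟨by rw [← NNReal.coe_lt_coe]; norm_num, LipschitzWith.of_dist_le_mul fun a b => ?_⟩
    have h1 := hJlip (x - t • T a) (x - t • T b)
    have h2 := hT.dist_le_mul a b
    rw [dist_eq_norm, dist_eq_norm] at h2 ⊢
    rw [show x - t • T a - (x - t • T b) = -(t • (T a - T b)) by module, norm_neg, norm_smul,
      Real.norm_eq_abs, abs_of_pos ht] at h1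
    have h3 := mul_le_mul_of_nonneg_left h2 ht.le
    have h4 := mul_le_mul_of_nonneg_right htρ (norm_nonneg (J (x - t • T a) - J (x - t • T b)))
    push_cast
    have : 0 < 1 - t * |ρ| := by linarith
    refine le_of_mul_le_mul_left ?_ this
    nlinarith [norm_nonneg (a - b)]
  have : Nonempty H := ⟨x⟩
  set p := hcontr.fixedPoint
  have hp : J (x - t • T p) = p := hcontr.fixedPoint_isFixedPt
  have hv := hV (x - t • T p)
  have hx := hJ (x - t • T p)
  rw [hp] at hv hx
  set v := V (x - t • T p)
  have hxp : x - p = t • (v + T p) := by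
    rw [smul_add, ← sub_eq_iff_eq_add'.2 hx]; abel
  have h1 := h p v hv
  rw [hxp, real_inner_smul_left, real_inner_self_eq_norm_sq] at h1
  have h2 : v + T p = 0 := norm_eq_zero.1 (pow_eq_zero_iff two_ne_zero |>.1
    (le_antisymm (nonpos_of_mul_nonpos_right h1 ht) (sq_nonneg _)))
  rw [h2, smul_zero, sub_eq_zero] at hxp
  rw [hxp, ← eq_neg_of_add_eq_zero_left h2]
  exact hv

end

/-! ### Attainment of `lipConst` and the quadratic bound from `lambdaMin`. -/

lemma lipschitzWith_lipConst {E F : Type*} [NormedAddCommGroup E] [NormedAddCommGroup F]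
    {T : E → F} {k : ℝ≥0} (hT : LipschitzWith k T) : LipschitzWith (lipConst T) T := by
  refine LipschitzWith.of_dist_le_mul fun x y => ?_
  rcases (dist_nonneg (x := x) (y := y)).eq_or_lt with h | h
  · simpa [← h] using hT.dist_le_mul x y
  rw [← div_le_iff₀ h]
  rw [← Real.toNNReal_le_iff_le_coe]
  refine le_csInf ⟨k, hT⟩ fun l hl => ?_
  rw [Real.toNNReal_le_iff_le_coe, div_le_iff₀ h]
  exact LipschitzWith.dist_le_mul hl x y

section
variable {H G : Type*} [NormedAddCommGroup H] [InnerProductSpace ℝ H]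
  [NormedAddCommGroup G] [InnerProductSpace ℝ G]

lemma lambdaMin_mul_le (L : H →L[ℝ] G) (K : G →L[ℝ] H) (x : H) :
    lambdaMin L K * ‖x‖ ^ 2 ≤ inner ℝ x (K (L x)) := by
  rcases eq_or_ne x 0 with rfl | hx
  · simp
  have hx' : 0 < ‖x‖ := norm_pos_iff.2 hx
  have h : lambdaMin L K ≤ inner ℝ (‖x‖⁻¹ • x) (K (L (‖x‖⁻¹ • x))) := by
    refine csInf_le ⟨-‖K.comp L‖, ?_⟩ ⟨_, by rw [norm_smul, norm_inv, norm_norm,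
      inv_mul_cancel₀ hx'.ne'], rfl⟩
    rintro _ ⟨y, hy, rfl⟩
    have h1 := (abs_le.1 (abs_real_inner_le_norm y (K (L y)))).1
    have h2 := (K.comp L).le_opNorm y
    rw [hy, mul_one] at h2
    rw [hy, one_mul] at h1
    exact (neg_le_neg h2).trans h1
  simp only [map_smul, real_inner_smul_left, real_inner_smul_right] at h
  have := mul_le_mul_of_nonneg_right h (sq_nonneg ‖x‖)
  refine this.trans_eq ?_
  field_simp

/-! ### Weak convergence and Opial's lemma. -/

lemma convergesWeakly_iff [CompleteSpace H] (z : ℕ → H) (l : H) :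
    ConvergesWeakly z l ↔ ∀ v, Tendsto (fun n => inner ℝ v (z n)) atTop (𝓝 (inner ℝ v l)) := by
  have hinj : Function.Injective ((topDualPairing ℝ H).flip) := by
    intro a b hab
    refine ext_inner_left ℝ fun v => ?_
    exact LinearMap.congr_fun hab (innerSL ℝ v)
  refine (WeakBilin.tendsto_iff_forall_eval_tendsto (topDualPairing ℝ H).flip hinj).trans ?_
  refine ⟨fun h v => h (innerSL ℝ v), fun h f => ?_⟩
  have := h ((InnerProductSpace.toDual ℝ H).symm f)
  simp only [InnerProductSpace.toDual_symm_apply] at this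
  exact this

/-- A bounded sequence converges weakly along every ultrafilter. -/
lemma exists_weak_limit_ultrafilter [CompleteSpace H] {z : ℕ → H} {R : ℝ} (hz : ∀ n, ‖z n‖ ≤ R)
    (U : Ultrafilter ℕ) :
    ∃ p, ∀ v, Tendsto (fun n => inner ℝ v (z n)) U (𝓝 (inner ℝ v p)) := by
  have hbd : ∀ v n, inner ℝ (z n) v ∈ Set.Icc (-(R * ‖v‖)) (R * ‖v‖) := by
    intro v n
    rw [← abs_le.trans Set.mem_Icc.symm]
    exact (abs_real_inner_le_norm _ _).trans (by gcongr; exact hz n)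
  have hex : ∀ v, ∃ l ∈ Set.Icc (-(R * ‖v‖)) (R * ‖v‖),
      Tendsto (fun n => inner ℝ (z n) v) U (𝓝 l) := by
    intro v
    obtain ⟨l, hl, h⟩ := isCompact_Icc.ultrafilter_le_nhds (U.map fun n => inner ℝ (z n) v)
      (le_principal_iff.2
        (Ultrafilter.mem_map.2 (mem_of_superset univ_mem fun n _ => hbd v n)))
    exact ⟨l, hl, h⟩
  choose l hl hlim using hex
  -- The limits along `U` depend linearly and boundedly on `v`; Riesz representation supplies the
  -- weak limit.
  let f : H →ₗ[ℝ] ℝ :=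
    { toFun := l
      map_add' := fun v w => tendsto_nhds_unique (hlim (v + w)) (by
        simpa only [inner_add_right] using (hlim v).add (hlim w))
      map_smul' := fun a v => tendsto_nhds_unique (hlim (a • v)) (by
        simpa [real_inner_smul_right] using (hlim v).const_mul a) }
  let F : H →L[ℝ] ℝ := f.mkContinuous R fun v => abs_le.2 (hl v)
  refine ⟨(InnerProductSpace.toDual ℝ H).symm F, fun v => ?_⟩
  rw [real_inner_comm, InnerProductSpace.toDual_symm_apply]
  change Tendsto _ _ (𝓝 (l v))
  simpa only [real_inner_comm] using hlim v

/-- Opial's lemma. -/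
lemma exists_convergesWeakly_of_opial [CompleteSpace H] {z : ℕ → H} {S : Set H} (hS : S.Nonempty)
    (hF : ∀ p ∈ S, ∃ l, Tendsto (fun n => ‖z n - p‖ ^ 2) atTop (𝓝 l))
    (hc : ∀ (U : Ultrafilter ℕ) (p : H), (U : Filter ℕ) ≤ atTop →
      (∀ v, Tendsto (fun n => inner ℝ v (z n)) U (𝓝 (inner ℝ v p))) → p ∈ S) :
    ∃ p ∈ S, ConvergesWeakly z p := by
  obtain ⟨R, hR⟩ : ∃ R, ∀ n, ‖z n‖ ≤ R := by
    obtain ⟨p, hp⟩ := hS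
    obtain ⟨l, hl⟩ := hF p hp
    obtain ⟨M, hM⟩ := hl.bddAbove_range
    refine ⟨√M + ‖p‖, fun n => ?_⟩
    have := Real.le_sqrt_of_sq_le (hM ⟨n, rfl⟩)
    calc ‖z n‖ = ‖z n - p + p‖ := by simp
      _ ≤ _ := (norm_add_le _ _).trans (by linarith)
  have huniq : ∀ (U V : Ultrafilter ℕ) (p q : H), (U : Filter ℕ) ≤ atTop →
      (V : Filter ℕ) ≤ atTop →
      (∀ v, Tendsto (fun n => inner ℝ v (z n)) U (𝓝 (inner ℝ v p))) →
      (∀ v, Tendsto (fun n => inner ℝ v (z n)) V (𝓝 (inner ℝ v q))) → p = q := by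
    intro U V p q hU hV hp hq
    obtain ⟨a, ha⟩ := hF p (hc U p hU hp)
    obtain ⟨b, hb⟩ := hF q (hc V q hV hq)
    -- Expanding the squares, `‖z n - q‖² - ‖z n - p‖²` determines this inner product, so it
    -- converges along the whole sequence and both ultrafilters see the same limit.
    have h : Tendsto (fun n => inner ℝ (p - q) (z n)) atTop
        (𝓝 ((b - a + ‖p‖ ^ 2 - ‖q‖ ^ 2) / 2)) := by
      convert (((hb.sub ha).add_const (‖p‖ ^ 2)).sub_const (‖q‖ ^ 2)).div_const 2 using 2 with n
      rw [norm_sub_sq_real, norm_sub_sq_real, inner_sub_left, real_inner_comm, real_inner_comm q]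
      ring
    have e1 := tendsto_nhds_unique (hp (p - q)) (h.mono_left hU)
    have e2 := tendsto_nhds_unique (hq (p - q)) (h.mono_left hV)
    have : inner ℝ (p - q) (p - q) = 0 := by rw [inner_sub_right, e1, e2, sub_self]
    exact sub_eq_zero.1 (inner_self_eq_zero.1 this)
  obtain ⟨p, hp⟩ := exists_weak_limit_ultrafilter hR (Ultrafilter.of atTop)
  refine ⟨p, hc _ p (Ultrafilter.of_le atTop) hp, (convergesWeakly_iff z p).2 fun v => ?_⟩
  rw [tendsto_iff_ultrafilter]
  intro V hV
  obtain ⟨q, hq⟩ := exists_weak_limit_ultrafilter hR V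
  rw [huniq _ _ p q (Ultrafilter.of_le atTop) hV hp hq]
  exact hq v

end

/-! ### Real recursions with summable or geometric perturbations. -/

/-- Deterministic quasi-Fejér convergence. -/
lemma tendsto_of_quasiFejer {s t a : ℕ → ℝ} (hs : ∀ n, 0 ≤ s n) (ht : ∀ n, 0 ≤ t n)
    (ha : ∀ n, 0 ≤ a n) (hsum : Summable a)
    (h : ∀ᶠ n in atTop, s (n + 1) ≤ s n - t n + a n * (1 + s n)) :
    (∃ l, Tendsto s atTop (𝓝 l)) ∧ Tendsto t atTop (𝓝 0) := by
  obtain ⟨N, hN⟩ := eventually_atTop.1 h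
  clear h
  wlog hN0 : N = 0 generalizing s t a N
  · obtain ⟨⟨l, hl⟩, h2⟩ := this (s := fun n => s (n + N)) (t := fun n => t (n + N))
      (a := fun n => a (n + N)) (fun n => hs _) (fun n => ht _) (fun n => ha _)
      ((summable_nat_add_iff N).2 hsum) 0
      (fun n _ => by simpa [add_right_comm] using hN (n + N) (by omega)) rfl
    exact ⟨⟨l, (tendsto_add_atTop_iff_nat N).1 hl⟩, (tendsto_add_atTop_iff_nat N).1 h2⟩
  subst hN0
  replace hN : ∀ n, s (n + 1) ≤ s n - t n + a n * (1 + s n) := fun n => hN n (Nat.zero_le n)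
  have hpart : ∀ n, ∑ i ∈ Finset.range n, a i ≤ ∑' i, a i := fun n =>
    hsum.sum_le_tsum _ fun i _ => ha i
  have hexp : ∀ n, 1 + s n ≤ (1 + s 0) * Real.exp (∑ i ∈ Finset.range n, a i) := by
    intro n
    induction n with
    | zero => simp
    | succ n ih =>
      rw [Finset.sum_range_succ, Real.exp_add, ← mul_assoc]
      calc 1 + s (n + 1) ≤ (1 + s n) * (1 + a n) := by linarith [hN n, ht n]
        _ ≤ _ := by
          have := ha n
          have := hs 0
          gcongr
          linarith [Real.add_one_le_exp (a n)]
  set M := (1 + s 0) * Real.exp (∑' i, a i)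
  have hM : ∀ n, 1 + s n ≤ M := fun n => (hexp n).trans (by
    have := hs 0
    exact mul_le_mul_of_nonneg_left (Real.exp_le_exp.2 (hpart n)) (by linarith))
  have hstep : ∀ n, s (n + 1) ≤ s n - t n + a n * M := fun n =>
    (hN n).trans (by gcongr; exacts [ha n, hM n])
  -- Since `1 + s n ≤ M`, subtracting the accumulated perturbation leaves a nonincreasing sequence,
  -- which is bounded below because `a` is summable.
  have hanti : Antitone fun n => s n - (∑ i ∈ Finset.range n, a i) * M := by
    refine antitone_nat_of_succ_le fun n => ?_
    rw [Finset.sum_range_succ]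
    linarith [hstep n, ht n]
  have hM0 : 0 ≤ M := by linarith [hM 0, hs 0]
  have hconv := tendsto_atTop_ciInf hanti ⟨-((∑' i, a i) * M), by
    rintro _ ⟨n, rfl⟩
    have := mul_le_mul_of_nonneg_right (hpart n) hM0
    simp only
    linarith [hs n]⟩
  have hs' := hconv.add (hsum.hasSum.tendsto_sum_nat.mul_const M)
  simp only [sub_add_cancel] at hs'
  refine ⟨⟨_, hs'⟩, ?_⟩
  have hup := (hs'.sub ((tendsto_add_atTop_iff_nat 1).2 hs')).add
    (hsum.tendsto_atTop_zero.mul_const M)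
  rw [sub_self, zero_mul, add_zero] at hup
  exact squeeze_zero ht (fun n => by linarith [hstep n]) hup

/-- A contractive recursion with a geometrically decaying perturbation decays geometrically. -/
lemma exists_geometric_bound {s : ℕ → ℝ} {a b η : ℝ} (ha1 : a < 1) (hb : 0 ≤ b)
    (hη : 0 ≤ η) (hη1 : η < 1) (hs : ∀ n, 0 ≤ s n)
    (h : ∀ᶠ n in atTop, s (n + 1) ≤ a * s n + b * η ^ n) :
    ∃ M q : ℝ, 0 ≤ M ∧ 0 < q ∧ q < 1 ∧ ∀ n, s n ≤ M * q ^ n := by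
  obtain ⟨N, hN⟩ := eventually_atTop.1 h
  set q := (1 + max a η) / 2
  have hm0 : 0 ≤ max a η := hη.trans (le_max_right _ _)
  have hm1 : max a η < 1 := max_lt ha1 hη1
  have hq0 : 0 < q := by simp only [q]; linarith
  have hq1 : q < 1 := by simp only [q]; linarith
  have haq : max a η < q := by simp only [q]; linarith
  have hηq : η ≤ q := by have := le_max_right a η; simp only [q]; linarith
  -- The first summand closes the induction, as `b η ^ n ≤ M (q - max a η) q ^ n`; the sum covers
  -- the indices up to `N`, where the recursion may not yet hold.
  set M := b / (q - max a η) + ∑ k ∈ Finset.range (N + 1), s k / q ^ k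
  have hsum0 : ∀ k ∈ Finset.range (N + 1), 0 ≤ s k / q ^ k := fun k _ =>
    div_nonneg (hs k) (pow_pos hq0 k).le
  have hqa : 0 < q - max a η := sub_pos.2 haq
  have hb' : 0 ≤ b / (q - max a η) := by positivity
  have hbM : b ≤ M * (q - max a η) := by
    rw [← div_le_iff₀ hqa]
    exact le_add_of_nonneg_right (Finset.sum_nonneg hsum0)
  have hM : 0 ≤ M := add_nonneg hb' (Finset.sum_nonneg hsum0)
  refine ⟨M, q, hM, hq0, hq1, fun n => ?_⟩
  have hsmall : ∀ n ≤ N, s n ≤ M * q ^ n := fun n hn => by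
    rw [← div_le_iff₀ (pow_pos hq0 n)]
    exact (Finset.single_le_sum hsum0 (Finset.mem_range.2 (by omega))).trans
      (le_add_of_nonneg_left hb')
  induction n with
  | zero => exact hsmall 0 (Nat.zero_le N)
  | succ n ih =>
    rcases lt_or_ge n N with hn | hn
    · exact hsmall _ hn
    · calc s (n + 1) ≤ a * s n + b * η ^ n := hN n hn
        _ ≤ max a η * (M * q ^ n) + M * (q - max a η) * q ^ n := by
          refine add_le_add ((mul_le_mul_of_nonneg_right (le_max_left a η) (hs n)).trans
            (mul_le_mul_of_nonneg_left ih hm0)) ?_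
          gcongr
        _ = M * q ^ (n + 1) := by ring

/-! ### The one-step estimate and the quasi-Fejér inequality. -/

section
variable {H G : Type*} [NormedAddCommGroup H] [InnerProductSpace ℝ H]
  [NormedAddCommGroup G] [InnerProductSpace ℝ G]

/-- One step of the forward-backward-half-forward iteration, for a perturbation `D'` of `D`. -/
lemma fbhf_step {ρ β m κ γ : ℝ} {A : H → Set H} (hA : IsRhoMonotone ρ A) (hβ : 0 < β)
    {C : H → H} (hC : IsCocoercive β C) {D D' : H → H}
    (hD : ∀ a b, m * ‖a - b‖ ^ 2 ≤ inner ℝ (a - b) (D a - D b))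
    (hD' : ∀ a b, ‖D' a - D' b‖ ≤ κ * ‖a - b‖) (hγ : 0 < γ) {p x z v z' : H}
    (hp : -(C p + D p) ∈ A p) (hv : v ∈ A x) (hx : z - γ • (C z + D' z) = x + γ • v)
    (hz' : z' = x + γ • (D' z - D' x)) :
    ‖z' - p‖ ^ 2 ≤ ‖z - p‖ ^ 2 - (1 - γ / (2 * β) - γ ^ 2 * κ ^ 2) * ‖z - x‖ ^ 2
      - 2 * γ * (ρ + m) * ‖x - p‖ ^ 2 + 2 * γ * (‖x - p‖ * ‖D' x - D x‖) := by
  have hmono := hA _ _ _ _ hv hp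
  have hDm := hD x p
  -- Split `x - p = (x - z) + (z - p)`; cocoercivity on the second part pays for the first by
  -- completing a square.
  have hcoc : -(‖z - x‖ ^ 2 / (4 * β)) ≤ inner ℝ (x - p) (C z - C p) := by
    have h1 := hC z p
    have h2 := (abs_le.1 (abs_real_inner_le_norm (x - z) (C z - C p))).1
    rw [norm_sub_rev x z] at h2
    have e : x - p = (x - z) + (z - p) := by abel
    rw [e, inner_add_left]
    have h3 : 0 ≤ (‖z - x‖ - 2 * β * ‖C z - C p‖) ^ 2 / (4 * β) := by positivity
    have h4 : (‖z - x‖ - 2 * β * ‖C z - C p‖) ^ 2 / (4 * β)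
      = ‖z - x‖ ^ 2 / (4 * β) - ‖z - x‖ * ‖C z - C p‖ + β * ‖C z - C p‖ ^ 2 := by
      field_simp; ring
    linarith
  have herr := (abs_le.1 (abs_real_inner_le_norm (x - p) (D' x - D x))).1
  have hlip : ‖z' - x‖ ^ 2 ≤ γ ^ 2 * κ ^ 2 * ‖z - x‖ ^ 2 := by
    have h : ‖z' - x‖ ≤ γ * (κ * ‖z - x‖) := by
      rw [hz', add_sub_cancel_left, norm_smul, Real.norm_eq_abs, abs_of_pos hγ]
      exact mul_le_mul_of_nonneg_left (hD' z x) hγ.le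
    calc _ ≤ (γ * (κ * ‖z - x‖)) ^ 2 := pow_le_pow_left₀ (norm_nonneg _) h 2
      _ = _ := by ring
  -- The half-forward correction trades `D' z` for `D' x`, so `D` is compared at `x` and `p`, and
  -- `D' - D` enters only at `x`.
  have hvec : z - z' = γ • (v - -(C p + D p)) + γ • (C z - C p) + γ • (D x - D p)
      + γ • (D' x - D x) := by
    have : γ • v = z - γ • (C z + D' z) - x := by rw [hx]; abel
    rw [hz', smul_sub γ v, this]
    module
  have hinner : inner ℝ (x - p) (z - z') = γ * inner ℝ (x - p) (v - -(C p + D p))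
      + γ * inner ℝ (x - p) (C z - C p) + γ * inner ℝ (x - p) (D x - D p)
      + γ * inner ℝ (x - p) (D' x - D x) := by
    rw [hvec]; simp only [inner_add_right, real_inner_smul_right]
  have hid : 2 * inner ℝ (x - p) (z - z')
      = ‖z - p‖ ^ 2 - ‖z' - p‖ ^ 2 - ‖z - x‖ ^ 2 + ‖z' - x‖ ^ 2 := by
    simp only [norm_sub_sq_real, inner_sub_left, inner_sub_right]
    rw [real_inner_comm x z, real_inner_comm x z', real_inner_comm p z, real_inner_comm p z']
    ring
  have key := mul_le_mul_of_nonneg_left (add_le_add (add_le_add (add_le_add hmono hcoc) hDm) herr)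
    hγ.le
  have e : γ / (2 * β) * ‖z - x‖ ^ 2 = 2 * γ * (‖z - x‖ ^ 2 / (4 * β)) := by field_simp; ring
  linarith

/-- The number `4β / (1 + r)` is the positive root of `1 - γ/(2β) - γ²κ²` (see `hroot`); staying `ε`
below it leaves a margin proportional to `ε`. -/
lemma le_one_sub_of_le_chi_sub {β κ ρ γ ε : ℝ} (hβ : 0 < β) (hγ : 0 ≤ γ) (hε : 0 ≤ ε)
    (h : γ ≤ chi β κ ρ - ε) :
    γ ≤ 4 * β ∧ ε / (4 * β) ≤ 1 - γ / (2 * β) - γ ^ 2 * κ ^ 2 := by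
  set r := √(1 + 16 * β ^ 2 * κ ^ 2)
  have hr : r ^ 2 = 1 + 16 * β ^ 2 * κ ^ 2 := Real.sq_sqrt (by positivity)
  have hr0 : 0 ≤ r := Real.sqrt_nonneg _
  set χ := 4 * β / (1 + r) with hχ
  have hle : γ ≤ χ - ε := by
    refine h.trans (sub_le_sub_right ?_ ε)
    unfold chi
    split_ifs
    exacts [le_rfl, min_le_left _ _]
  have hχβ : χ ≤ 4 * β := div_le_self (by positivity) (by linarith)
  have hroot : χ * (1 / (2 * β) + χ * κ ^ 2) = 1 := by
    have h1 : κ ^ 2 = (r ^ 2 - 1) / (16 * β ^ 2) := by rw [hr]; field_simp; ring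
    rw [hχ, h1]
    field_simp
    ring
  have h2 : ε / (4 * β) ≤ ε * (1 / (2 * β) + χ * κ ^ 2) := by
    rw [div_eq_mul_one_div]
    refine mul_le_mul_of_nonneg_left ?_ hε
    have h3 : 1 / (4 * β) ≤ 1 / (2 * β) := one_div_le_one_div_of_le (by positivity) (by linarith)
    have : 0 ≤ χ * κ ^ 2 := by positivity
    linarith
  have h4 : γ ^ 2 * κ ^ 2 ≤ γ * (χ * κ ^ 2) := by
    have : γ * (γ * κ ^ 2) ≤ γ * (χ * κ ^ 2) := by gcongr; linarith
    linarith
  have h5 : γ * (1 / (2 * β) + χ * κ ^ 2) ≤ (χ - ε) * (1 / (2 * β) + χ * κ ^ 2) := by gcongr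
  refine ⟨by linarith, ?_⟩
  have h6 : γ / (2 * β) = γ * (1 / (2 * β)) := by ring
  linarith

/-- The `G`-valued part `x ↦ α (L x - c) + B L x` of `dOp`. -/
def dualResidual (α : ℝ) (L : H →L[ℝ] G) (c : G) (B : G → G) (x : H) : G := α • (L x - c) + B (L x)

lemma dOp_eq (α : ℝ) (L : H →L[ℝ] G) (c : G) (B : G → G) (M : G →L[ℝ] H) (x : H) :
    dOp α L c B M x = M (dualResidual α L c B x) := by
  simp [dOp, dualResidual]

lemma norm_dualResidual_sub_le {α : ℝ} (hα : 0 ≤ α) (L : H →L[ℝ] G) (c : G) {B : G → G} {ζ : ℝ≥0}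
    (hB : LipschitzWith ζ B) (x y : H) :
    ‖dualResidual α L c B x - dualResidual α L c B y‖ ≤ (α + ζ) * ‖L‖ * ‖x - y‖ := by
  have h1 := hB.dist_le_mul (L x) (L y)
  rw [dist_eq_norm, dist_eq_norm, ← map_sub] at h1
  have h2 := L.le_opNorm (x - y)
  have e : dualResidual α L c B x - dualResidual α L c B y = α • L (x - y) + (B (L x) - B (L y)) := by
    simp only [dualResidual, map_sub]; module
  rw [e]
  calc _ ≤ ‖α • L (x - y)‖ + ‖B (L x) - B (L y)‖ := norm_add_le _ _
    _ ≤ α * ‖L (x - y)‖ + ζ * ‖L (x - y)‖ := by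
      rw [norm_smul, Real.norm_eq_abs, abs_of_nonneg hα]; gcongr
    _ = (α + ζ) * ‖L (x - y)‖ := by ring
    _ ≤ _ := by rw [mul_assoc]; gcongr

lemma norm_dOp_sub_le {α : ℝ} (L : H →L[ℝ] G) (c : G) {B : G → G} {ζ : ℝ≥0}
    (hB : LipschitzWith ζ B) (K : G →L[ℝ] H) (x y : H) :
    ‖dOp α L c B K x - dOp α L c B K y‖ ≤ kappa α L B K * ‖x - y‖ := by
  have hT : LipschitzWith (‖K‖₊ * ((‖α‖₊ * ‖L‖₊) + ζ * ‖L‖₊))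
      (fun x : H => K (α • L x + B (L x))) :=
    K.lipschitz.comp (((lipschitzWith_smul α).comp L.lipschitz).add (hB.comp L.lipschitz))
  have := (lipschitzWith_lipConst hT).dist_le_mul x y
  rw [dist_eq_norm, dist_eq_norm] at this
  have e : dOp α L c B K x - dOp α L c B K y
      = K (α • L x + B (L x)) - K (α • L y + B (L y)) := by
    simp only [dOp, map_sub, map_add, map_smul]
    module
  rw [e]
  exact this

/-- Decompose `K B L = L* B L - (L* - K) B L`: the first term is monotone, the second is
Lipschitzian with constant `ζ̃`, and the affine part contributes `α λ_min`. -/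
lemma le_inner_dOp_sub [CompleteSpace H] [CompleteSpace G] {α : ℝ} (hα : 0 ≤ α) (L : H →L[ℝ] G)
    (c : G) {B : G → G} {ζ : ℝ≥0} (hB : IsMonotoneMap B) (hBLip : LipschitzWith ζ B)
    (K : G →L[ℝ] H) (x y : H) :
    (α * lambdaMin L K - zetaTilde L B (ContinuousLinearMap.adjoint L - K)) * ‖x - y‖ ^ 2
      ≤ inner ℝ (x - y) (dOp α L c B K x - dOp α L c B K y) := by
  set N := ContinuousLinearMap.adjoint L - K with hN
  have h1 := mul_le_mul_of_nonneg_left (lambdaMin_mul_le L K (x - y)) hα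
  have h2 := (lipschitzWith_lipConst (N.lipschitz.comp (hBLip.comp L.lipschitz))).dist_le_mul x y
  have h3 := hB (L x) (L y)
  rw [dist_eq_norm, dist_eq_norm] at h2
  change ‖N (B (L x)) - N (B (L y))‖ ≤ zetaTilde L B N * ‖x - y‖ at h2
  rw [← map_sub] at h2
  have h4 := (real_inner_le_norm (x - y) (N (B (L x) - B (L y)))).trans
    (mul_le_mul_of_nonneg_left h2 (norm_nonneg _))
  rw [← map_sub, ← ContinuousLinearMap.adjoint_inner_right] at h3
  have e : dOp α L c B K x - dOp α L c B K y = α • K (L (x - y))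
      + (ContinuousLinearMap.adjoint L (B (L x) - B (L y)) - N (B (L x) - B (L y))) := by
    simp only [hN, sub_apply, dOp, map_sub]
    module
  rw [e, inner_add_right, inner_sub_right, real_inner_smul_right]
  nlinarith

lemma mem_solutions_iff {A : H → Set H} {C : H → H} {α : ℝ} {L : H →L[ℝ] G} {c : G} {B : G → G}
    {K : G →L[ℝ] H} {p : H} :
    p ∈ solutions A C α L c B K ↔ -(C p + dOp α L c B K p) ∈ A p := by
  refine ⟨fun ⟨v, hv, h⟩ => ?_, fun h => ⟨_, h, by rw [dOp]; abel⟩⟩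
  convert hv using 1
  rw [neg_eq_iff_add_eq_zero, dOp, h]
  abel

/-- The quasi-Fejér inequality satisfied by the iteration. -/
lemma exists_quasiFejer_const [CompleteSpace H] [CompleteSpace G]
    {ρ β α : ℝ} {ζ : ℝ≥0} (hβ : 0 < β) (hα : 0 ≤ α)
    {A : H → Set H} (hA : IsRhoMonotone ρ A) {C : H → H} (hC : IsCocoercive β C)
    {B : G → G} (hB : IsMonotoneMap B) (hBLip : LipschitzWith ζ B)
    {L : H →L[ℝ] G} {K : G →L[ℝ] H} {c : G}
    (hρ : 0 ≤ rhoHat ρ α L B K)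
    {Kn : ℕ → G →L[ℝ] H} {ω : ℕ → ℝ} (hω : ∀ n, 0 ≤ ω n) (hωsum : Summable ω)
    (hKn : ∀ n, ‖Kn n - K‖ ≤ ω n) {ε : ℝ} (hε : 0 < ε)
    {γ : ℕ → ℝ} (hγ : ∀ n, γ n ∈ Set.Icc ε (chi β (kappa α L B K) ρ - ε))
    {u y x z : ℕ → H} (hz : IsFBHF A C α L c B Kn γ u y x z)
    {p : H} (hp : p ∈ solutions A C α L c B K) :
    ∃ a, 0 ≤ a ∧ ∀ n, ‖z (n + 1) - p‖ ^ 2 ≤ ‖z n - p‖ ^ 2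
      - (ε / (4 * β) - a * ω n) * ‖z n - x n‖ ^ 2 - 2 * ε * rhoHat ρ α L B K * ‖x n - p‖ ^ 2
      + a * ω n * (1 + ‖z n - p‖ ^ 2) := by
  set b := (α + ζ) * ‖L‖
  have hb : 0 ≤ b := by positivity
  set r := ‖dualResidual α L c B p‖
  have hr : 0 ≤ r := norm_nonneg _
  set W := ∑' n, ω n
  have hW : ∀ n, ω n ≤ W := fun n => hωsum.le_tsum n fun i _ => hω i
  have hW0 : 0 ≤ W := tsum_nonneg hω
  set κ := kappa α L B K with hκ
  have hκ0 : 0 ≤ κ := NNReal.coe_nonneg _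
  have hpA := mem_solutions_iff.1 hp
  -- The first summand bounds the growth of the squared Lipschitz constant from `κ ^ 2` to `(κ + ω n
  -- * b) ^ 2`, using `γ n ≤ 4 * β` and `ω n ≤ W`. The second bounds the error `D_{K_n} - D_K` at `x
  -- n`, which need not vanish at `p`, hence the `1` beside `‖z n - p‖²`.
  refine ⟨(4 * β) ^ 2 * (2 * κ * b + W * b ^ 2) + 4 * β * (2 * r + 4 * b), by positivity,
    fun n => ?_⟩
  obtain ⟨hγε, hγχ⟩ := hγ n
  have hγ0 : 0 < γ n := hε.trans_le hγε
  obtain ⟨hγβ, hδ⟩ := le_one_sub_of_le_chi_sub hβ hγ0.le hε.le hγχ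
  have herr : ∀ q w, ‖(Kn n) q - K q - (Kn n w - K w)‖ ≤ ω n * ‖q - w‖ := fun q w => by
    have := (Kn n - K).le_of_opNorm_le (hKn n) (q - w)
    simpa only [map_sub, sub_apply] using this
  have hD' : ∀ q w, ‖dOp α L c B (Kn n) q - dOp α L c B (Kn n) w‖
      ≤ (κ + ω n * b) * ‖q - w‖ := fun q w => by
    have h1 := norm_dOp_sub_le (α := α) L c hBLip K q w
    have h2 := herr (dualResidual α L c B q) (dualResidual α L c B w)
    have h3 := mul_le_mul_of_nonneg_left (norm_dualResidual_sub_le hα L c hBLip q w) (hω n)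
    rw [dOp_eq, dOp_eq] at h1 ⊢
    have h4 := norm_add_le (K (dualResidual α L c B q) - K (dualResidual α L c B w))
      ((Kn n) (dualResidual α L c B q) - K (dualResidual α L c B q)
        - (Kn n (dualResidual α L c B w) - K (dualResidual α L c B w)))
    refine le_trans (le_of_eq ?_) (h4.trans (by linarith))
    congr 1
    abel
  obtain ⟨_, ⟨v, hv, rfl⟩, hx⟩ := hz.x_mem n
  rw [hz.y_eq, hz.u_eq] at hx
  have hz' := hz.z_succ n
  rw [hz.u_eq] at hz'
  have hstep := fbhf_step hA hβ hC (le_inner_dOp_sub hα L c hB hBLip K) hD' hγ0 hpA hv hx hz'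
  have hρ' : ρ + (α * lambdaMin L K - zetaTilde L B (ContinuousLinearMap.adjoint L - K))
      = rhoHat ρ α L B K := by rw [rhoHat]; ring
  rw [hρ'] at hstep
  have hE : ‖dOp α L c B (Kn n) (x n) - dOp α L c B K (x n)‖ ≤ ω n * (r + b * ‖x n - p‖) := by
    rw [dOp_eq, dOp_eq, ← sub_apply]
    refine ((Kn n - K).le_of_opNorm_le (hKn n) _).trans (mul_le_mul_of_nonneg_left ?_ (hω n))
    have h1 := norm_dualResidual_sub_le hα L c hBLip (x n) p
    have h2 := norm_add_le (dualResidual α L c B (x n) - dualResidual α L c B p) (dualResidual α L c B p)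
    rw [sub_add_cancel] at h2
    linarith
  set X := ‖x n - p‖
  set Z := ‖z n - p‖
  set d := ‖z n - x n‖
  have hX0 : 0 ≤ X := norm_nonneg _
  have hX2 : X ^ 2 ≤ 2 * Z ^ 2 + 2 * d ^ 2 := by
    have h1 : X ≤ Z + d := by
      have := norm_sub_le (z n - p) (z n - x n)
      rwa [sub_sub_sub_cancel_left] at this
    nlinarith [sq_nonneg (Z - d), norm_nonneg (z n - p), norm_nonneg (z n - x n)]
  have hω' := hω n
  have t1 : γ n ^ 2 * (κ + ω n * b) ^ 2 * d ^ 2 ≤ γ n ^ 2 * κ ^ 2 * d ^ 2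
      + (4 * β) ^ 2 * (2 * κ * b + W * b ^ 2) * ω n * d ^ 2 := by
    have h1 : (κ + ω n * b) ^ 2 ≤ κ ^ 2 + ω n * (2 * κ * b + W * b ^ 2) := by
      have : ω n * (ω n * b ^ 2) ≤ ω n * (W * b ^ 2) := by gcongr; exact hW n
      linarith
    have h2 : γ n ^ 2 * (ω n * (2 * κ * b + W * b ^ 2)) ≤
        (4 * β) ^ 2 * (ω n * (2 * κ * b + W * b ^ 2)) := by gcongr
    have h3 : γ n ^ 2 * (κ + ω n * b) ^ 2 ≤ γ n ^ 2 * κ ^ 2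
        + (4 * β) ^ 2 * (2 * κ * b + W * b ^ 2) * ω n := by
      have := mul_le_mul_of_nonneg_left h1 (sq_nonneg (γ n))
      linarith
    have := mul_le_mul_of_nonneg_right h3 (sq_nonneg d)
    linarith
  have t2 : 2 * γ n * (X * ‖dOp α L c B (Kn n) (x n) - dOp α L c B K (x n)‖)
      ≤ 4 * β * (2 * r + 4 * b) * ω n * (1 + Z ^ 2 + d ^ 2) := by
    have h1 : 2 * (X * (r + b * X)) ≤ (2 * r + 4 * b) * (1 + Z ^ 2 + d ^ 2) := by
      have e1 : r * (2 * X) ≤ r * (1 + X ^ 2) := by gcongr; nlinarith [sq_nonneg (X - 1)]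
      have e2 : r * X ^ 2 ≤ r * (2 * Z ^ 2 + 2 * d ^ 2) := by gcongr
      have e3 : b * X ^ 2 ≤ b * (2 * Z ^ 2 + 2 * d ^ 2) := by gcongr
      linarith
    calc _ ≤ 2 * γ n * (X * (ω n * (r + b * X))) := by gcongr
      _ = γ n * (ω n * (2 * (X * (r + b * X)))) := by ring
      _ ≤ 4 * β * (ω n * ((2 * r + 4 * b) * (1 + Z ^ 2 + d ^ 2))) := by gcongr
      _ = _ := by ring
  have t3 : ε * rhoHat ρ α L B K * X ^ 2 ≤ γ n * rhoHat ρ α L B K * X ^ 2 := by gcongr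
  have t4 := mul_le_mul_of_nonneg_right hδ (sq_nonneg d)
  have t5 : 0 ≤ (4 * β) ^ 2 * (2 * κ * b + W * b ^ 2) * ω n * (1 + Z ^ 2) := by positivity
  linarith

end

/-! ### Monotonicity of the full operator and weak cluster points. -/

section
variable {H G : Type*} [NormedAddCommGroup H] [InnerProductSpace ℝ H]
  [NormedAddCommGroup G] [InnerProductSpace ℝ G]

lemma AdjointMismatch.IsCocoercive.norm_sub_le {β : ℝ} (hβ : 0 < β) {C : H → H}
    (hC : IsCocoercive β C) (x y : H) : ‖C x - C y‖ ≤ β⁻¹ * ‖x - y‖ := by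
  have h := (hC x y).trans (real_inner_le_norm _ _)
  rcases (norm_nonneg (C x - C y)).eq_or_lt with h0 | h0
  · rw [← h0]; positivity
  · rw [inv_mul_eq_div, le_div_iff₀ hβ]
    refine le_of_mul_le_mul_right ?_ h0
    linarith

lemma rhoHat_mul_le_inner [CompleteSpace H] [CompleteSpace G]
    {ρ β α : ℝ} {ζ : ℝ≥0} (hβ : 0 < β) (hα : 0 ≤ α)
    {A : H → Set H} (hA : IsRhoMonotone ρ A) {C : H → H} (hC : IsCocoercive β C)
    {B : G → G} (hB : IsMonotoneMap B) (hBLip : LipschitzWith ζ B)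
    (L : H →L[ℝ] G) (K : G →L[ℝ] H) (c : G) {x y v w : H} (hv : v ∈ A x) (hw : w ∈ A y) :
    rhoHat ρ α L B K * ‖x - y‖ ^ 2 ≤ inner ℝ (x - y)
      (v + (C x + dOp α L c B K x) - (w + (C y + dOp α L c B K y))) := by
  have h1 := hA _ _ _ _ hv hw
  have h2 := hC x y
  have h3 := le_inner_dOp_sub hα L c hB hBLip K x y
  have h4 : 0 ≤ β * ‖C x - C y‖ ^ 2 := by positivity
  have e : v + (C x + dOp α L c B K x) - (w + (C y + dOp α L c B K y))
    = (v - w) + (C x - C y) + (dOp α L c B K x - dOp α L c B K y) := by abel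
  rw [e, inner_add_right, inner_add_right, rhoHat]
  linarith

/-- Weak cluster points of the iteration are solutions once `z n - x n → 0`. -/
lemma mem_solutions_of_weak_limit [CompleteSpace H] [CompleteSpace G]
    {ρ β α : ℝ} {ζ : ℝ≥0} (hβ : 0 < β) (hα : 0 ≤ α)
    {A : H → Set H} (hA : IsMaximallyRhoMonotone ρ A) {C : H → H} (hC : IsCocoercive β C)
    {B : G → G} (hB : IsMonotoneMap B) (hBLip : LipschitzWith ζ B)
    {L : H →L[ℝ] G} {K : G →L[ℝ] H} {c : G}
    (hρ : 0 ≤ rhoHat ρ α L B K)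
    {Kn : ℕ → G →L[ℝ] H} {ω : ℕ → ℝ} (hω : Tendsto ω atTop (𝓝 0))
    (hKn : ∀ n, ‖Kn n - K‖ ≤ ω n) {ε : ℝ} (hε : 0 < ε)
    {γ : ℕ → ℝ} (hγ : ∀ n, ε ≤ γ n)
    {u y x z : ℕ → H} (hz : IsFBHF A C α L c B Kn γ u y x z)
    {R : ℝ} (hR : ∀ n, ‖z n‖ ≤ R) (hzx : Tendsto (fun n => ‖z n - x n‖) atTop (𝓝 0))
    {U : Ultrafilter ℕ} (hU : (U : Filter ℕ) ≤ atTop) {p : H}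
    (hp : ∀ v, Tendsto (fun n => inner ℝ v (z n)) U (𝓝 (inner ℝ v p))) :
    p ∈ solutions A C α L c B K := by
  set T : H → H := fun x => C x + dOp α L c B K x with hT
  set κ := kappa α L B K
  have hκ0 : 0 ≤ κ := NNReal.coe_nonneg _
  set k := β⁻¹ + κ
  have hk : 0 ≤ k := by positivity
  have hTk : ∀ a b, ‖T a - T b‖ ≤ k * ‖a - b‖ := fun a b => by
    have h1 := hC.norm_sub_le hβ a b
    have h2 := norm_dOp_sub_le (α := α) L c hBLip K a b
    rw [hT]
    simp only
    rw [add_sub_add_comm, add_mul]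
    exact (norm_add_le _ _).trans (add_le_add h1 h2)
  have hTlip : LipschitzWith k.toNNReal T := LipschitzWith.of_dist_le_mul fun a b => by
    rw [dist_eq_norm, dist_eq_norm, Real.coe_toNNReal _ hk]
    exact hTk a b
  have hx : ∀ n, ∃ v ∈ A (x n), z n - γ n • (C (z n) + dOp α L c B (Kn n) (z n))
      = x n + γ n • v := fun n => by
    obtain ⟨_, ⟨v, hv, rfl⟩, h⟩ := hz.x_mem n
    rw [hz.y_eq, hz.u_eq] at h
    exact ⟨v, hv, h⟩
  choose v hv hxv using hx
  set b := (α + ζ) * ‖L‖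
  have hb : 0 ≤ b := by positivity
  set Q := b * R + ‖dualResidual α L c B 0‖
  -- The vector `v n + T (x n)` lies in `(A + T) (x n)` and tends strongly to `0`. Pairing it with
  -- `x n - q` and using monotonicity relates the weak limit to the graph of `A + T`, with no weak
  -- continuity of `T`.
  have hw : ∀ n, ‖v n + T (x n)‖ ≤ (ε⁻¹ + k) * ‖z n - x n‖ + ω n * Q := fun n => by
    have hγ0 : 0 < γ n := hε.trans_le (hγ n)
    have e : v n + T (x n) = (γ n)⁻¹ • (z n - x n) - (T (z n) - T (x n))
        - (Kn n - K) (dualResidual α L c B (z n)) := by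
      have h1 : v n = (γ n)⁻¹ • (γ n • v n) := by
        rw [smul_smul, inv_mul_cancel₀ hγ0.ne', one_smul]
      have h2 : γ n • v n = (z n - x n) - γ n • (C (z n) + dOp α L c B (Kn n) (z n)) := by
        rw [sub_right_comm, hxv n]; abel
      rw [h1, h2, smul_sub, smul_smul, inv_mul_cancel₀ hγ0.ne', one_smul]
      simp only [hT, dOp_eq, sub_apply]
      abel
    have h1 : ‖(γ n)⁻¹ • (z n - x n)‖ ≤ ε⁻¹ * ‖z n - x n‖ := by
      rw [norm_smul, norm_inv, Real.norm_eq_abs, abs_of_pos hγ0]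
      gcongr
      exact hγ n
    have h2 := hTk (z n) (x n)
    have h3 : ‖dualResidual α L c B (z n)‖ ≤ Q := by
      have h4 := norm_dualResidual_sub_le hα L c hBLip (z n) 0
      rw [sub_zero] at h4
      have h5 := norm_add_le (dualResidual α L c B (z n) - dualResidual α L c B 0)
        (dualResidual α L c B 0)
      rw [sub_add_cancel] at h5
      have h6 : b * ‖z n‖ ≤ b * R := by gcongr; exact hR n
      linarith
    have h4 : ‖(Kn n - K) (dualResidual α L c B (z n))‖ ≤ ω n * Q :=
      ((Kn n - K).le_of_opNorm_le (hKn n) _).trans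
        (mul_le_mul_of_nonneg_left h3 ((norm_nonneg _).trans (hKn n)))
    rw [e]
    have h5 := norm_sub_le ((γ n)⁻¹ • (z n - x n) - (T (z n) - T (x n)))
      ((Kn n - K) (dualResidual α L c B (z n)))
    have h6 := norm_sub_le ((γ n)⁻¹ • (z n - x n)) (T (z n) - T (x n))
    linarith
  have hw0 : Tendsto (fun n => ‖v n + T (x n)‖) atTop (𝓝 0) := by
    refine squeeze_zero (fun _ => norm_nonneg _) hw ?_
    simpa using (hzx.const_mul (ε⁻¹ + k)).add (hω.mul_const Q)
  obtain ⟨R', hR'⟩ := hzx.bddAbove_range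
  have hxU : ∀ a, Tendsto (fun n => inner ℝ (x n) a) U (𝓝 (inner ℝ p a)) := fun a => by
    have h1 : Tendsto (fun n => inner ℝ a (z n - x n)) atTop (𝓝 0) := by
      refine squeeze_zero_norm (fun n => norm_inner_le_norm (𝕜 := ℝ) _ _) ?_
      simpa using hzx.const_mul ‖a‖
    have h2 := (hp a).sub (h1.mono_left hU)
    simp only [inner_sub_right, sub_sub_cancel, sub_zero] at h2
    simpa only [real_inner_comm] using h2
  rw [mem_solutions_iff]
  refine hA.neg_mem_of_related hTlip fun q a ha => ?_
  have hright : Tendsto (fun n => (R + R' + ‖q‖) * ‖v n + T (x n)‖) U (𝓝 0) := by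
    simpa using (hw0.const_mul (R + R' + ‖q‖)).mono_left hU
  have hleft : Tendsto (fun n => inner ℝ (x n - q) (a + T q)) U (𝓝 (inner ℝ (p - q) (a + T q))) := by
    simp only [inner_sub_left]
    exact (hxU _).sub_const _
  refine le_of_tendsto_of_tendsto' hleft hright fun n => ?_
  have h1 := rhoHat_mul_le_inner hβ hα hA.1 hC hB hBLip L K c (hv n) ha
  have h2 := mul_nonneg hρ (sq_nonneg ‖x n - q‖)
  rw [inner_sub_right] at h1
  have h3 := real_inner_le_norm (x n - q) (v n + T (x n))
  have h4 : ‖x n - q‖ ≤ R + R' + ‖q‖ := by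
    have e : x n - q = z n - (z n - x n) - q := by abel
    rw [e]
    have h5 := norm_sub_le (z n - (z n - x n)) q
    have h6 := norm_sub_le (z n) (z n - x n)
    have h7 : ‖z n - x n‖ ≤ R' := hR' ⟨n, rfl⟩
    linarith [hR n]
  have h5 := mul_le_mul_of_nonneg_right h4 (norm_nonneg (v n + T (x n)))
  simp only [hT] at h1 h3 h5 ⊢
  linarith

end

/-! ### The convergence theorem. -/

theorem mainTheorem1 {H G : Type*}
    [NormedAddCommGroup H] [InnerProductSpace ℝ H] [CompleteSpace H]
    [NormedAddCommGroup G] [InnerProductSpace ℝ G] [CompleteSpace G]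
    (ρ β α : ℝ) (ζ : ℝ≥0) (hβ : 0 < β) (hζ : 0 < ζ) (hα : 0 ≤ α)
    (A : H → Set H) (hA : IsMaximallyRhoMonotone ρ A)
    (C : H → H) (hC : IsCocoercive β C)
    (B : G → G) (hB : IsMonotoneMap B) (hBLip : LipschitzWith ζ B)
    (L : H →L[ℝ] G) (K : G →L[ℝ] H) (c : G)
    (hsol : (solutions A C α L c B K).Nonempty)
    (hDK : dOp α L c B K ≠ 0)
    (hρ : 0 ≤ rhoHat ρ α L B K)
    (Kn : ℕ → G →L[ℝ] H) (ω : ℕ → ℝ) (hω : ∀ n, 0 ≤ ω n) (hωsum : Summable ω)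
    (hKn : ∀ n, ‖Kn n - K‖ ≤ ω n)
    (ε : ℝ) (hε : ε ∈ Set.Ioo 0 (chi β (kappa α L B K) ρ / 2))
    (γ : ℕ → ℝ) (hγ : ∀ n, γ n ∈ Set.Icc ε (chi β (kappa α L B K) ρ - ε))
    (u y x z : ℕ → H) (hz : IsFBHF A C α L c B Kn γ u y x z) :
    (∃ zbar ∈ solutions A C α L c B K, ConvergesWeakly z zbar) ∧
    (0 < rhoHat ρ α L B K →
      (∃ η : ℝ, 0 ≤ η ∧ η < 1 ∧ ∀ n, ω n = ω 0 * η ^ n) →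
      ∃ zstar, solutions A C α L c B K = {zstar} ∧ ConvergesLinearly z zstar) := by
  have hε0 : 0 < ε := hε.1
  -- Half of the margin `ε / (4 * β)`; the other half eventually absorbs `a * ω n`.
  set δ := ε / (8 * β)
  have hδ : 0 < δ := by positivity
  have hδ2 : ε / (4 * β) = 2 * δ := by simp only [δ]; field_simp; ring
  have hω0 := hωsum.tendsto_atTop_zero
  have hineq : ∀ p ∈ solutions A C α L c B K, ∃ a, 0 ≤ a ∧ ∀ᶠ n in atTop,
      ‖z (n + 1) - p‖ ^ 2 ≤ ‖z n - p‖ ^ 2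
        - (δ * ‖z n - x n‖ ^ 2 + 2 * ε * rhoHat ρ α L B K * ‖x n - p‖ ^ 2)
        + a * ω n * (1 + ‖z n - p‖ ^ 2) := by
    intro p hp
    obtain ⟨a, ha, h⟩ := exists_quasiFejer_const hβ hα hA.1 hC hB hBLip hρ hω hωsum hKn hε0 hγ hz hp
    refine ⟨a, ha, ?_⟩
    have h0 : Tendsto (fun n => a * ω n) atTop (𝓝 0) := by simpa using hω0.const_mul a
    filter_upwards [h0.eventually_le_const hδ] with n hn
    have h1 := h n
    rw [hδ2] at h1
    have := mul_le_mul_of_nonneg_right hn (sq_nonneg ‖z n - x n‖)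
    linarith
  have hfejer : ∀ p ∈ solutions A C α L c B K,
      (∃ l, Tendsto (fun n => ‖z n - p‖ ^ 2) atTop (𝓝 l)) ∧
      Tendsto (fun n => ‖z n - x n‖) atTop (𝓝 0) := by
    intro p hp
    obtain ⟨a, ha, h⟩ := hineq p hp
    obtain ⟨h1, h2⟩ := tendsto_of_quasiFejer (s := fun n => ‖z n - p‖ ^ 2)
      (t := fun n => δ * ‖z n - x n‖ ^ 2 + 2 * ε * rhoHat ρ α L B K * ‖x n - p‖ ^ 2)
      (a := fun n => a * ω n) (fun _ => sq_nonneg _) (fun _ => by positivity)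
      (fun n => mul_nonneg ha (hω n)) (hωsum.mul_left a) h
    refine ⟨h1, ?_⟩
    have h3 : Tendsto (fun n => ‖z n - x n‖ ^ 2) atTop (𝓝 0) := by
      refine squeeze_zero (fun _ => sq_nonneg _) (fun n => ?_)
        (by simpa using h2.const_mul δ⁻¹ : Tendsto (fun n => δ⁻¹ * (δ * ‖z n - x n‖ ^ 2
          + 2 * ε * rhoHat ρ α L B K * ‖x n - p‖ ^ 2)) atTop (𝓝 0))
      rw [inv_mul_eq_div, le_div_iff₀ hδ, mul_comm]
      exact le_add_of_nonneg_right (by positivity)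
    simpa using h3.sqrt
  obtain ⟨p, hp⟩ := hsol
  obtain ⟨⟨l, hl⟩, hzx⟩ := hfejer p hp
  obtain ⟨M, hM⟩ := hl.bddAbove_range
  replace hM : ∀ n, ‖z n - p‖ ^ 2 ≤ M := fun n => hM ⟨n, rfl⟩
  refine ⟨?_, fun hρ' ⟨η, hη0, hη1, hη⟩ => ⟨p, ?_, ?_⟩⟩
  · have hR : ∀ n, ‖z n‖ ≤ √M + ‖p‖ := fun n => by
      have h1 := norm_add_le (z n - p) p
      rw [sub_add_cancel] at h1
      linarith [Real.le_sqrt_of_sq_le (hM n)]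
    exact exists_convergesWeakly_of_opial ⟨p, hp⟩ (fun q hq => (hfejer q hq).1)
      fun U q hU hq => mem_solutions_of_weak_limit hβ hα hA hC hB hBLip hρ hω0 hKn hε0
        (fun n => (hγ n).1) hz hR hzx hU hq
  · refine Set.eq_singleton_iff_unique_mem.2 ⟨hp, fun q hq => ?_⟩
    have h := rhoHat_mul_le_inner hβ hα hA.1 hC hB hBLip L K c (mem_solutions_iff.1 hq)
      (mem_solutions_iff.1 hp)
    rw [neg_add_cancel, neg_add_cancel, sub_zero, inner_zero_right] at h
    exact sub_eq_zero.1 (norm_eq_zero.1 (pow_eq_zero_iff two_ne_zero |>.1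
      (le_antisymm (nonpos_of_mul_nonpos_right h hρ') (sq_nonneg _))))
  · obtain ⟨a, ha, h⟩ := hineq p hp
    -- Chosen so that `‖z n - p‖² ≤ 2 ‖z n - x n‖² + 2 ‖x n - p‖²` makes `θ ‖z n - p‖²` at most the
    -- decrease in `hineq`.
    set θ := min (δ / 2) (ε * rhoHat ρ α L B K)
    have hθ : 0 < θ := lt_min (by positivity) (by positivity)
    have hM0 : 0 ≤ M := (sq_nonneg _).trans (hM 0)
    obtain ⟨M', q, hM', hq0, hq1, hb⟩ := exists_geometric_bound (s := fun n => ‖z n - p‖ ^ 2)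
      (a := 1 - θ) (b := a * ω 0 * (1 + M)) (by linarith)
      (mul_nonneg (mul_nonneg ha (hω 0)) (by linarith)) hη0 hη1 (fun _ => sq_nonneg _) (by
        filter_upwards [h] with n hn
        have h1 : a * ω n * (1 + ‖z n - p‖ ^ 2) ≤ a * ω n * (1 + M) :=
          mul_le_mul_of_nonneg_left (by linarith [hM n]) (mul_nonneg ha (hω n))
        rw [hη n] at h1
        rw [hη n] at hn
        have h2 : ‖z n - p‖ ^ 2 ≤ 2 * ‖z n - x n‖ ^ 2 + 2 * ‖x n - p‖ ^ 2 := by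
          have h3 := norm_add_le (z n - x n) (x n - p)
          rw [sub_add_sub_cancel] at h3
          nlinarith [norm_nonneg (z n - p), sq_nonneg (‖z n - x n‖ - ‖x n - p‖)]
        have h3 := mul_le_mul_of_nonneg_left h2 hθ.le
        have h4 := mul_le_mul_of_nonneg_right (min_le_left (δ / 2) (ε * rhoHat ρ α L B K))
          (sq_nonneg ‖z n - x n‖)
        have h5 := mul_le_mul_of_nonneg_right (min_le_right (δ / 2) (ε * rhoHat ρ α L B K))
          (sq_nonneg ‖x n - p‖)
        linarith)
    refine ⟨√M', √q, Real.sqrt_nonneg _, Real.sqrt_pos.2 hq0,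
      (Real.sqrt_lt' one_pos).2 (by simpa using hq1), fun n => ?_⟩
    refine (pow_le_pow_iff_left₀ (norm_nonneg _) (by positivity) two_ne_zero).1 ?_
    rw [mul_pow, Real.sq_sqrt hM', ← pow_mul, mul_comm n, pow_mul, Real.sq_sqrt hq0.le]
    exact hb n
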